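/- An \emph{outside-obstacle representation} (OOR) of a finite graph $G$ is an injective placement $p\colon V(G)\to\mathbb{R}^2$ such that two distinct vertices $x,y$ are adjacent in $G$ if and only if the segment $\overline{p(x)p(y)}$ does not intersect the outer face (the unbounded component of the complement) of the straight-line drawing of $G$ given by $p$. An OOR is \emph{regular} if $p$ maps the $n$ vertices of $G$ bijectively onto the vertices of a regular $n$-gon. \textbf{Proposition.} There is an 8-vertex outerplanar graph $H$ that has no regular OOR. Moreover, $H$ can be chosen as follows. There is a 6-vertex outerplanar graph $G$ that has, up to rotation and mirroring (that is, as placements of its labelled vertices, up to similarities of the plane), exactly two regular OORs, and $H$ is obtained from $G$ by choosing two distinct edges $ac$ and $bc$ of $G$ with a common endpoint $c$ and adding two new vertices $u$ and $w$ of degree $2$, where $u$ is adjacent exactly to $b$ and $c$, and $w$ is adjacent exactly to $a$ and $c$. No placement of the vertices of $H$ on a regular octagon is an OOR of $H$; in particular, no insertion of $u$ and $w$ into the circular vertex order of a regular OOR of $G$ yields one. -/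

import Mathlib

/-- The outer face of a (bounded) plane set `D`: the union of the unbounded connected
components of the complement of `D`. -/
def outerFace (D : Set ℂ) : Set ℂ :=
  {z | z ∈ Dᶜ ∧ ¬ Bornology.IsBounded (connectedComponentIn Dᶜ z)}

/-- `A` is a simple arc in the plane with endpoints `x` and `y`. -/
def IsSimpleArc (A : Set ℂ) (x y : ℂ) : Prop :=
  ∃ γ : Path x y, Function.Injective γ ∧ Set.range γ = A

/-- `pt`, `arc` form a crossing-free drawing of `G` in the plane: distinct vertices are distinct
points, every edge is a simple arc joining its two endpoints and containing no other vertex, and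
two distinct edges meet at most in common endpoints. -/
structure IsPlaneDrawing {V : Type*} (G : SimpleGraph V)
    (pt : V → ℂ) (arc : G.edgeSet → Set ℂ) : Prop where
  pt_injective : Function.Injective pt
  arc_joins : ∀ (u v : V) (h : G.Adj u v), IsSimpleArc (arc ⟨s(u, v), h⟩) (pt u) (pt v)
  vertex_mem_arc : ∀ (e : G.edgeSet) (v : V), pt v ∈ arc e → v ∈ (e : Sym2 V)
  arc_inter_arc : ∀ e f : G.edgeSet, e ≠ f →
    arc e ∩ arc f ⊆ pt '' {v | v ∈ (e : Sym2 V) ∧ v ∈ (f : Sym2 V)}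

/-- `G` is outerplanar: it has a crossing-free plane drawing in which every vertex is incident to
the outer face. -/
def IsOuterplanar {V : Type*} (G : SimpleGraph V) : Prop :=
  ∃ (pt : V → ℂ) (arc : G.edgeSet → Set ℂ), IsPlaneDrawing G pt arc ∧
    ∀ v, pt v ∈ closure (outerFace (Set.range pt ∪ ⋃ e, arc e))

/-- The point set covered by the straight-line drawing of `G` with vertex positions `p`. -/
def straightDrawing {V : Type*} (G : SimpleGraph V) (p : V → ℂ) : Set ℂ :=
  Set.range p ∪ {z | ∃ u v, G.Adj u v ∧ z ∈ segment ℝ (p u) (p v)}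

/-- `p` is an outside-obstacle representation (OOR) of `G`: the vertices are distinct points and
`G` is the visibility graph of these points with respect to the single obstacle that is the
outer face of the straight-line drawing. -/
def IsOOR {V : Type*} (G : SimpleGraph V) (p : V → ℂ) : Prop :=
  Function.Injective p ∧
    ∀ u v, u ≠ v →
      (G.Adj u v ↔ Disjoint (segment ℝ (p u) (p v)) (outerFace (straightDrawing G p)))

/-- `p` places the `n` elements of `V` bijectively on the vertices of a regular `n`-gon
(with centre `c`; the complex factor `a` encodes circumradius and rotation). -/
def IsRegularPlacement {V : Type*} [Fintype V] (p : V → ℂ) : Prop :=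
  ∃ (c a : ℂ) (e : V ≃ Fin (Fintype.card V)), a ≠ 0 ∧
    ∀ v, p v = c + a * Complex.exp
      (2 * (Real.pi : ℂ) * Complex.I * ((e v : ℕ) : ℂ) / (Fintype.card V : ℂ))

/-- A regular OOR: an OOR whose vertices form a regular polygon. -/
def IsRegularOOR {V : Type*} [Fintype V] (G : SimpleGraph V) (p : V → ℂ) : Prop :=
  IsRegularPlacement p ∧ IsOOR G p

/-- Two placements of the same labelled vertices agree up to a similarity of the plane, possibly
orientation-reversing. For placements on regular polygons this says that they agree up to
rotation and mirroring (and position and size of the polygon). -/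
def SamePlacement {V : Type*} (p q : V → ℂ) : Prop :=
  ∃ a b : ℂ, a ≠ 0 ∧
    ((∀ v, q v = a * p v + b) ∨ (∀ v, q v = a * (starRingEnd ℂ) (p v) + b))

/-! The six-vertex graph is a triangle `0 2 4` with an ear `1`, `3`, `5` on each side; the
eight-vertex graph adds ears `6` and `7` on the edges `12` and `01`. Which chords of a convex
polygon cross depends only on the circular order of the vertices, so most placements can be judged
combinatorially.

To refute a circular order, take drawn edges that cross or touch in a cyclic chain and intersect the
half-planes to their left. The boundary of this intersection is covered by the edges, so the outer
face cannot enter it (`disjoint_leftRegion_outerFace`). If it contains a nonadjacent pair, the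
segment of that pair misses the outer face and the placement is not an OOR
(`not_isOOR_of_hasShieldedPair`). The obstruction persists when further vertices are inserted, so
`searchOrders` can prune partial orders. For the hexagon, two orders and their mirror images remain.

To confirm an order, every nonadjacent segment is shown to enter an open wedge that avoids the
drawing; such a wedge is unbounded and connected, hence lies in the outer face
(`mem_outerFace_of_wedge`, `isOOR_of_wedges`).

For the octagon, each order that survives pruning contains two triangles which, by a computation
with the regular octagon, jointly cover a nonadjacent chord (`not_isOOR_of_octagon_triangles`). Only
this last argument against an order uses regularity beyond convex position. -/

/-! ### Orientation of point triples -/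

/-- Twice the signed area of the triangle `a b z`: positive iff `z` is to the left of `a → b`. -/
def orient (a b z : ℂ) : ℝ := (b.re - a.re) * (z.im - a.im) - (b.im - a.im) * (z.re - a.re)

theorem orient_swap (a b z : ℂ) : orient b a z = -orient a b z := by
  unfold orient; ring

theorem orient_rotate (a b z : ℂ) : orient b z a = orient a b z := by
  unfold orient; ring

@[simp] theorem orient_left (a b : ℂ) : orient a b a = 0 := by unfold orient; ring

@[simp] theorem orient_right (a b : ℂ) : orient a b b = 0 := by unfold orient; ring

theorem orient_lineMap (a b x y : ℂ) (t : ℝ) :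
    orient a b (AffineMap.lineMap x y t) = (1 - t) * orient a b x + t * orient a b y := by
  simp only [orient, AffineMap.lineMap_apply_module', Complex.add_re, Complex.add_im,
    Complex.real_smul, Complex.mul_re, Complex.mul_im, Complex.ofReal_re, Complex.ofReal_im,
    Complex.sub_re, Complex.sub_im]
  ring

theorem continuous_orient (a b : ℂ) : Continuous (orient a b) := by
  unfold orient; fun_prop

theorem exists_lineMap_of_orient_eq_zero {a b z : ℂ} (hab : a ≠ b) (hz : orient a b z = 0) :
    ∃ t : ℝ, AffineMap.lineMap a b t = z := by
  have hne : b - a ≠ 0 := sub_ne_zero.2 hab.symm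
  have hpos : (b.re - a.re) ^ 2 + (b.im - a.im) ^ 2 ≠ 0 := by
    intro h
    apply hne
    apply Complex.ext
    · simp only [Complex.sub_re, Complex.zero_re]; nlinarith
    · simp only [Complex.sub_im, Complex.zero_im]; nlinarith
  refine ⟨((b.re - a.re) * (z.re - a.re) + (b.im - a.im) * (z.im - a.im)) /
    ((b.re - a.re) ^ 2 + (b.im - a.im) ^ 2), ?_⟩
  unfold orient at hz
  apply Complex.ext
  · simp only [AffineMap.lineMap_apply_module', Complex.add_re, Complex.real_smul, Complex.mul_re,
      Complex.ofReal_re, Complex.ofReal_im, Complex.sub_re]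
    field_simp
    linear_combination (b.im - a.im) * hz
  · simp only [AffineMap.lineMap_apply_module', Complex.add_im, Complex.real_smul, Complex.mul_im,
      Complex.ofReal_re, Complex.ofReal_im, Complex.sub_im]
    field_simp
    linear_combination -(b.re - a.re) * hz

theorem mem_segment_iff_lineMap {x y z : ℂ} :
    z ∈ segment ℝ x y ↔ ∃ t : ℝ, 0 ≤ t ∧ t ≤ 1 ∧ AffineMap.lineMap x y t = z := by
  rw [segment_eq_image_lineMap]
  constructor
  · rintro ⟨t, ⟨h0, h1⟩, rfl⟩; exact ⟨t, h0, h1, rfl⟩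
  · rintro ⟨t, h0, h1, rfl⟩; exact ⟨t, ⟨h0, h1⟩, rfl⟩

/-! ### Convex regions shielded from the outer face -/

/-- The region to the left of all the directed lines in the list `C`. -/
def leftRegion (C : List (ℂ × ℂ)) : Set ℂ := {z | ∀ c ∈ C, 0 ≤ orient c.1 c.2 z}

/-- `d` separates the tip `q` of the directed segment `p → q` from its tail `p`: the line of `d`
has `p` weakly to its left and `q` weakly to its right. -/
def CutsTip (d : ℂ × ℂ) (p q : ℂ) : Prop :=
  0 ≤ orient d.1 d.2 p ∧ orient d.1 d.2 q ≤ 0 ∧ (0 < orient d.1 d.2 p ∨ orient d.1 d.2 q < 0)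

/-- Off the frontier, the interior of `R` and the complement of its closure are disjoint open sets
covering `K`, so a connected `K` stays in one of them. -/
theorem IsPreconnected.subset_of_disjoint_frontier {K R : Set ℂ} (hK : IsPreconnected K)
    (hR : Disjoint K (frontier R)) (hne : (K ∩ R).Nonempty) : K ⊆ R := by
  have hcov : K ⊆ interior R ∪ (closure R)ᶜ := by
    intro z hz
    by_cases h1 : z ∈ interior R
    · exact Or.inl h1
    · refine Or.inr fun h2 => Set.disjoint_left.1 hR hz ⟨h2, h1⟩
  obtain ⟨z, hzK, hzR⟩ := hne
  have hz : z ∈ interior R := by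
    rcases hcov hzK with h | h
    · exact h
    · exact absurd (subset_closure hzR) h
  have := hK.subset_left_of_subset_union isOpen_interior isClosed_closure.isOpen_compl
    (Set.disjoint_left.2 fun w h1 h2 => h2 (subset_closure (interior_subset h1))) hcov
    ⟨z, hzK, hz⟩
  exact this.trans interior_subset

/-- A frontier point lies on the line of some `c ∈ C`. Beyond either end of the segment `c`, the
constraint of a cutting chord `d` becomes negative, so the point lies on the segment itself. -/
theorem frontier_leftRegion_subset {D : Set ℂ} {C : List (ℂ × ℂ)}
    (hseg : ∀ c ∈ C, segment ℝ c.1 c.2 ⊆ D) (hne : ∀ c ∈ C, c.1 ≠ c.2)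
    (hnext : ∀ c ∈ C, ∃ d ∈ C, CutsTip d c.1 c.2) (hprev : ∀ c ∈ C, ∃ d ∈ C, CutsTip d c.2 c.1) :
    frontier (leftRegion C) ⊆ D := by
  intro z hz
  have hclosed : IsClosed (leftRegion C) := by
    have : leftRegion C = ⋂ c ∈ C, {z | 0 ≤ orient c.1 c.2 z} := by ext; simp [leftRegion]
    rw [this]
    exact isClosed_biInter fun c _ => isClosed_le continuous_const (continuous_orient _ _)
  have hzR : z ∈ leftRegion C := hclosed.frontier_subset hz
  obtain ⟨c, hc, hcz⟩ : ∃ c ∈ C, orient c.1 c.2 z = 0 := by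
    by_contra! hcon
    apply hz.2
    have hopen : IsOpen (⋂ c ∈ {c | c ∈ C}, {z | 0 < orient c.1 c.2 z}) :=
      C.finite_toSet.isOpen_biInter
        fun c _ => isOpen_lt continuous_const (continuous_orient _ _)
    refine mem_interior.2 ⟨_, ?_, hopen, ?_⟩
    · intro w hw c hc
      exact (Set.mem_iInter₂.1 hw c hc).le
    · exact Set.mem_iInter₂.2 fun c hc => lt_of_le_of_ne (hzR c hc) (hcon c hc).symm
  obtain ⟨t, rfl⟩ := exists_lineMap_of_orient_eq_zero (hne c hc) hcz
  refine hseg c hc (mem_segment_iff_lineMap.2 ⟨t, ?_, ?_, rfl⟩)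
  · by_contra! ht
    obtain ⟨d, hd, h1, h2, h3⟩ := hprev c hc
    have := hzR d hd
    rw [orient_lineMap] at this
    rcases h3 with h3 | h3 <;> nlinarith
  · by_contra! ht
    obtain ⟨d, hd, h1, h2, h3⟩ := hnext c hc
    have := hzR d hd
    rw [orient_lineMap] at this
    rcases h3 with h3 | h3 <;> nlinarith

/-- The point of the circle in the direction of the right-hand normal `-i(b - a)` works, because the
line through `a` and `b` comes closer to the origin than `r`. -/
theorem exists_mem_sphere_orient_neg {a b : ℂ} (hab : a ≠ b) {r : ℝ} (hr : ‖a‖ < r) :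
    ∃ w ∈ Metric.sphere (0 : ℂ) r, orient a b w < 0 := by
  have hn : 0 < ‖b - a‖ := norm_pos_iff.2 (sub_ne_zero.2 hab.symm)
  have hr0 : 0 ≤ r := (norm_nonneg a).trans hr.le
  refine ⟨((r / ‖b - a‖ : ℝ) : ℂ) * (-Complex.I * (b - a)), ?_, ?_⟩
  · rw [mem_sphere_zero_iff_norm, norm_mul, norm_mul, norm_neg, Complex.norm_I,
      Complex.norm_real, Real.norm_of_nonneg (by positivity)]
    field_simp
  · have hsq : ‖b - a‖ * ‖b - a‖ = (b.re - a.re) ^ 2 + (b.im - a.im) ^ 2 := by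
      rw [Complex.norm_mul_self_eq_normSq, Complex.normSq_apply]
      simp only [Complex.sub_re, Complex.sub_im]; ring
    have hI : -((b.re - a.re) * a.im - (b.im - a.im) * a.re) ≤ ‖b - a‖ * ‖a‖ := by
      have h1 := Complex.abs_im_le_norm ((starRingEnd ℂ) (b - a) * a)
      rw [norm_mul, Complex.norm_conj] at h1
      have h2 : ((starRingEnd ℂ) (b - a) * a).im =
          (b.re - a.re) * a.im - (b.im - a.im) * a.re := by
        simp [Complex.mul_im]; ring
      rw [h2] at h1
      exact (neg_le_abs _).trans h1
    have key : orient a b (((r / ‖b - a‖ : ℝ) : ℂ) * (-Complex.I * (b - a))) =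
        -(r * ‖b - a‖) - ((b.re - a.re) * a.im - (b.im - a.im) * a.re) := by
      have : r * ‖b - a‖ = r / ‖b - a‖ * ((b.re - a.re) ^ 2 + (b.im - a.im) ^ 2) := by
        rw [← hsq]; field_simp
      rw [this]
      simp [orient, Complex.mul_im, Complex.mul_re]
      ring
    rw [key]
    nlinarith

/-- A convex region bounded by pieces of a bounded set `D` is not entered by the outer face. -/
theorem disjoint_leftRegion_outerFace {D : Set ℂ} {C : List (ℂ × ℂ)} (hC : C ≠ [])
    (hD : Bornology.IsBounded D)
    (hseg : ∀ c ∈ C, segment ℝ c.1 c.2 ⊆ D) (hne : ∀ c ∈ C, c.1 ≠ c.2)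
    (hnext : ∀ c ∈ C, ∃ d ∈ C, CutsTip d c.1 c.2)
    (hprev : ∀ c ∈ C, ∃ d ∈ C, CutsTip d c.2 c.1) :
    Disjoint (leftRegion C) (outerFace D) := by
  have hfr := frontier_leftRegion_subset hseg hne hnext hprev
  rw [Set.disjoint_left]
  rintro z hzR ⟨hzD, hub⟩
  obtain ⟨M, hM⟩ := hD.exists_norm_le
  have hsub : connectedComponentIn Dᶜ z ⊆ leftRegion C :=
    isPreconnected_connectedComponentIn.subset_of_disjoint_frontier
      (Set.disjoint_left.2 fun w h1 h2 => connectedComponentIn_subset _ _ h1 (hfr h2))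
      ⟨z, mem_connectedComponentIn hzD, hzR⟩
  obtain ⟨w, hw, hwM⟩ : ∃ w ∈ connectedComponentIn Dᶜ z, M < ‖w‖ := by
    by_contra! hcon
    exact hub (isBounded_iff_forall_norm_le.2 ⟨M, hcon⟩)
  -- An unbounded component inside the region reaches a circle enclosing all of `D`. That whole
  -- circle then lies in the region, although part of it is to the right of any chord in `C`.
  have hsph : Metric.sphere (0 : ℂ) ‖w‖ ⊆ leftRegion C := by
    refine (isConnected_sphere (by simp) 0 (norm_nonneg w)).isPreconnected
      |>.subset_of_disjoint_frontier ?_ ⟨w, by simp, hsub hw⟩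
    refine Set.disjoint_left.2 fun v h1 h2 => ?_
    have := hM v (hfr h2)
    rw [mem_sphere_zero_iff_norm] at h1
    linarith
  obtain ⟨c, hc⟩ := List.exists_mem_of_ne_nil C hC
  have hcD : c.1 ∈ D := hseg c hc (left_mem_segment ℝ _ _)
  obtain ⟨v, hv, hneg⟩ := exists_mem_sphere_orient_neg (hne c hc) ((hM _ hcD).trans_lt hwM)
  exact absurd (hsph hv c hc) (not_le.2 hneg)

theorem segment_subset_leftRegion {C : List (ℂ × ℂ)} {x y : ℂ} (hx : x ∈ leftRegion C)
    (hy : y ∈ leftRegion C) : segment ℝ x y ⊆ leftRegion C := by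
  intro z hz c hc
  obtain ⟨t, h0, h1, rfl⟩ := mem_segment_iff_lineMap.1 hz
  rw [orient_lineMap]
  have := hx c hc
  have := hy c hc
  have : 0 ≤ 1 - t := by linarith
  positivity

/-! ### Wedges in the outer face -/

/-- A point of a drawing-free open wedge lies in the outer face. -/
theorem mem_outerFace_of_wedge {D : Set ℂ} {a b c d z : ℂ}
    (hD : ∀ w ∈ D, orient a b w ≤ 0 ∨ orient c d w ≤ 0)
    (h1 : 0 < orient a b z) (h2 : 0 < orient c d z) : z ∈ outerFace D := by
  let K : Set ℂ := {w | 0 < orient a b w} ∩ {w | 0 < orient c d w}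
  have hconv : ∀ a b : ℂ, Convex ℝ {w | 0 < orient a b w} := by
    intro a b
    refine convex_iff_segment_subset.2 fun x hx y hy w hw => ?_
    obtain ⟨t, h0, h1, rfl⟩ := mem_segment_iff_lineMap.1 hw
    have hx' : 0 < orient a b x := hx
    have hy' : 0 < orient a b y := hy
    change 0 < orient a b _
    rw [orient_lineMap]
    rcases h0.eq_or_lt with rfl | h0
    · simpa using hx'
    · have : 0 ≤ 1 - t := by linarith
      positivity
  have hKD : K ⊆ Dᶜ := fun w hw hwD =>
    (hD w hwD).elim (fun h => absurd hw.1 (not_lt.2 h)) (fun h => absurd hw.2 (not_lt.2 h))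
  have hzK : z ∈ K := ⟨h1, h2⟩
  have hsub : K ⊆ connectedComponentIn Dᶜ z :=
    ((hconv a b).inter (hconv c d)).isPreconnected.subset_connectedComponentIn hzK hKD
  have hab : b - a ≠ 0 := by
    rintro h
    rw [sub_eq_zero.1 h] at h1
    simp [orient] at h1
  -- A direction parallel to `ab`, with its sign chosen so that moving along it does not leave the
  -- second half-plane: the wedge contains a ray from `z`.
  obtain ⟨v, hv0, hv1, hv2⟩ : ∃ v : ℂ, v ≠ 0 ∧
      (b.re - a.re) * v.im - (b.im - a.im) * v.re = 0 ∧
      0 ≤ (d.re - c.re) * v.im - (d.im - c.im) * v.re := by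
    rcases le_total 0 ((d.re - c.re) * (b - a).im - (d.im - c.im) * (b - a).re) with h | h
    · exact ⟨b - a, hab, by simp; ring, h⟩
    · refine ⟨-(b - a), neg_ne_zero.2 hab, by simp; ring, ?_⟩
      rw [Complex.neg_re, Complex.neg_im]
      linarith
  refine ⟨hKD hzK, fun hb => ?_⟩
  obtain ⟨M, hM⟩ := (hb.subset hsub).exists_norm_le
  have hvn : 0 < ‖v‖ := norm_pos_iff.2 hv0
  have hM0 : 0 ≤ M := (norm_nonneg z).trans (hM z hzK)
  let s : ℝ := (M + ‖z‖ + 1) / ‖v‖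
  have hs : 0 ≤ s := by positivity
  have hmem : z + (s : ℂ) * v ∈ K := by
    refine ⟨?_, ?_⟩
    · have : orient a b (z + (s : ℂ) * v) = orient a b z +
          s * ((b.re - a.re) * v.im - (b.im - a.im) * v.re) := by
        simp [orient]; ring
      change 0 < orient a b _
      rw [this, hv1]; simpa using h1
    · have : orient c d (z + (s : ℂ) * v) = orient c d z +
          s * ((d.re - c.re) * v.im - (d.im - c.im) * v.re) := by
        simp [orient]; ring
      change 0 < orient c d _
      rw [this]; positivity
  have h3 := hM _ hmem
  have h4 : ‖(s : ℂ) * v‖ = M + ‖z‖ + 1 := by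
    rw [norm_mul, Complex.norm_real, Real.norm_of_nonneg hs]
    exact div_mul_cancel₀ _ hvn.ne'
  have h5 : ‖(s : ℂ) * v‖ ≤ ‖z + (s : ℂ) * v‖ + ‖z‖ := by
    simpa using norm_sub_le (z + (s : ℂ) * v) z
  linarith

theorem isBounded_straightDrawing {V : Type*} [Finite V] (G : SimpleGraph V) (p : V → ℂ) :
    Bornology.IsBounded (straightDrawing G p) := by
  have h : Bornology.IsBounded (convexHull ℝ (Set.range p)) :=
    isBounded_convexHull.2 (Set.finite_range p).isBounded
  refine h.subset ?_
  rintro z (hz | ⟨u, v, -, hz⟩)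
  · exact subset_convexHull ℝ _ hz
  · exact segment_subset_convexHull (Set.mem_range_self u) (Set.mem_range_self v) hz

/-! ### Convex position and combinatorial shields -/

/-- The points `z 0, …, z (n - 1)` are in convex position, in counterclockwise order. -/
def ConvexSeq (z : ℕ → ℂ) (n : ℕ) : Prop :=
  ∀ i j k, i < j → j < k → k < n → 0 < orient (z i) (z j) (z k)

/-- `i`, `j`, `k` are distinct and in this cyclic order. -/
def ccw (i j k : ℕ) : Bool :=
  (decide (i < j) && decide (j < k)) || (decide (j < k) && decide (k < i)) ||
    (decide (k < i) && decide (i < j))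

theorem ConvexSeq.orient_pos {z : ℕ → ℂ} {n i j k : ℕ} (hz : ConvexSeq z n) (hi : i < n)
    (hj : j < n) (hk : k < n) (h : ccw i j k = true) : 0 < orient (z i) (z j) (z k) := by
  simp only [ccw, Bool.or_eq_true, Bool.and_eq_true, decide_eq_true_eq] at h
  rcases h with (⟨h1, h2⟩ | ⟨h1, h2⟩) | ⟨h1, h2⟩
  · exact hz i j k h1 h2 hk
  · exact orient_rotate (z i) (z j) (z k) ▸ hz j k i h1 h2 hi
  · exact (orient_rotate (z k) (z i) (z j)).symm ▸ hz k i j h1 h2 hj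

/-- Asking that the reversed triple is not `ccw` allows coinciding indices, where the orientation is
zero. -/
theorem ConvexSeq.orient_nonneg {z : ℕ → ℂ} {n i j k : ℕ} (hz : ConvexSeq z n) (hi : i < n)
    (hj : j < n) (hk : k < n) (h : ccw j i k = false) : 0 ≤ orient (z i) (z j) (z k) := by
  by_cases hij : i = j
  · subst hij; unfold orient; apply le_of_eq; ring
  by_cases hik : i = k
  · subst hik; simp
  by_cases hjk : j = k
  · subst hjk; simp
  refine (hz.orient_pos hi hj hk ?_).le
  simp only [ccw, Bool.or_eq_true, Bool.and_eq_true, decide_eq_true_eq, Bool.or_eq_false_iff,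
    Bool.and_eq_false_iff, decide_eq_false_iff_not] at h ⊢
  omega

theorem ConvexSeq.orient_nonpos {z : ℕ → ℂ} {n i j k : ℕ} (hz : ConvexSeq z n) (hi : i < n)
    (hj : j < n) (hk : k < n) (h : ccw i j k = false) : orient (z i) (z j) (z k) ≤ 0 := by
  have := hz.orient_nonneg hj hi hk h
  rw [orient_swap] at this
  linarith

theorem ConvexSeq.comp {z : ℕ → ℂ} {n m : ℕ} (hz : ConvexSeq z n) {e : ℕ → ℕ}
    (he : ∀ i j, i < j → j < m → e i < e j) (hn : ∀ i, e i < n) :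
    ConvexSeq (fun i => z (e i)) m :=
  fun i j k hij hjk hk => hz _ _ _ (he i j hij (hjk.trans hk)) (he j k hjk hk) (hn k)

/-- Combinatorial form of `CutsTip` for chords of a convex polygon. -/
def cutsTip (d : ℕ × ℕ) (p q : ℕ) : Bool :=
  !ccw d.2 d.1 p && !ccw d.1 d.2 q && (ccw d.1 d.2 p || ccw d.2 d.1 q)

/-- `C` is a cyclic chain of crossing or touching edges. -/
def isShield (A : ℕ → ℕ → Bool) (m : ℕ) (C : List (ℕ × ℕ)) : Bool :=
  !C.isEmpty && C.all fun c => decide (c.1 < m) && decide (c.2 < m) && A c.1 c.2 &&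
    (C.any fun d => cutsTip d c.1 c.2) && C.any fun d => cutsTip d c.2 c.1

/-- The polygon vertex `x` lies to the left of all the chords in `C`. -/
def isLeftOf (C : List (ℕ × ℕ)) (x : ℕ) : Bool := C.all fun c => !ccw c.2 c.1 x

/-- A greedy chain of chords that shields the side of the polygon between the positions `x + cur`
and `x + last` (mod `m`). -/
def greedyChain (A : ℕ → ℕ → Bool) (m x last : ℕ) : ℕ → ℕ → List (ℕ × ℕ)
  | 0, _ => []
  | fuel + 1, cur =>
    match (List.range (last + 1)).reverse.findSome? fun s =>
      if s ≤ cur then none else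
        ((List.range (cur + 1)).find? fun r => A ((x + r) % m) ((x + s) % m)).map fun r =>
          (r, s) with
    | none => []
    | some (r, s) => ((x + r) % m, (x + s) % m) :: greedyChain A m x last fuel s

/-- Some nonadjacent pair of positions is shielded on both sides. -/
def hasShieldedPair (A : ℕ → ℕ → Bool) (m : ℕ) : Bool :=
  (List.range m).any fun x => (List.range m).any fun y =>
    decide (x < y) && !A x y &&
      -- One chain for each side of the chord `xy`. The greedy choice needs no correctness proof,
      -- since the tests on the next line certify whatever it returns.
      let C := greedyChain A m x (y - x) m 0 ++ greedyChain A m y (m - (y - x)) m 0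
      isShield A m C && isLeftOf C x && isLeftOf C y

theorem ConvexSeq.mem_leftRegion {z : ℕ → ℂ} {m x : ℕ} (hz : ConvexSeq z m)
    {C : List (ℕ × ℕ)} (hC : ∀ c ∈ C, c.1 < m ∧ c.2 < m) (hx : x < m)
    (h : isLeftOf C x = true) : z x ∈ leftRegion (C.map fun c => (z c.1, z c.2)) := by
  intro c hc
  obtain ⟨c', hc', rfl⟩ := List.mem_map.1 hc
  refine hz.orient_nonneg (hC c' hc').1 (hC c' hc').2 hx ?_
  simpa using List.all_eq_true.1 h c' hc'

theorem ConvexSeq.cutsTip {z : ℕ → ℂ} {m p q : ℕ} {d : ℕ × ℕ} (hz : ConvexSeq z m)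
    (hd1 : d.1 < m) (hd2 : d.2 < m) (hp : p < m) (hq : q < m) (h : cutsTip d p q = true) :
    CutsTip (z d.1, z d.2) (z p) (z q) := by
  simp only [_root_.cutsTip, Bool.and_eq_true, Bool.not_eq_true', Bool.or_eq_true] at h
  obtain ⟨⟨h1, h2⟩, h3⟩ := h
  refine ⟨hz.orient_nonneg hd1 hd2 hp h1, hz.orient_nonpos hd1 hd2 hq h2, ?_⟩
  rcases h3 with h3 | h3
  · exact Or.inl (hz.orient_pos hd1 hd2 hp h3)
  · right
    have := hz.orient_pos hd2 hd1 hq h3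
    rw [orient_swap] at this
    change orient (z d.1) (z d.2) (z q) < 0
    linarith

theorem isShield_lt {A : ℕ → ℕ → Bool} {m : ℕ} {C : List (ℕ × ℕ)} (h : isShield A m C = true) :
    ∀ c ∈ C, c.1 < m ∧ c.2 < m := by
  intro c hc
  simp only [isShield, Bool.and_eq_true, List.all_eq_true, decide_eq_true_eq] at h
  exact ⟨(h.2 c hc).1.1.1.1, (h.2 c hc).1.1.1.2⟩

section Shield

variable {V : Type*} {G : SimpleGraph V} {p : V → ℂ}

theorem disjoint_shield_outerFace [Finite V] (hp : Function.Injective p) {f : ℕ → V} {m : ℕ}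
    (hz : ConvexSeq (fun i => p (f i)) m) {A : ℕ → ℕ → Bool}
    (hA : ∀ i j, A i j = true → G.Adj (f i) (f j)) {C : List (ℕ × ℕ)}
    (h : isShield A m C = true) :
    Disjoint (leftRegion (C.map fun c => (p (f c.1), p (f c.2))))
      (outerFace (straightDrawing G p)) := by
  have hlt := isShield_lt h
  simp only [isShield, Bool.and_eq_true, List.all_eq_true, List.any_eq_true,
    Bool.not_eq_true', List.isEmpty_eq_false_iff] at h
  obtain ⟨hne, h⟩ := h
  refine disjoint_leftRegion_outerFace (by simpa using hne) (isBounded_straightDrawing G p)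
    ?_ ?_ ?_ ?_
  · intro c hc
    obtain ⟨c', hc', rfl⟩ := List.mem_map.1 hc
    exact fun w hw => Or.inr ⟨_, _, hA _ _ (h c' hc').1.1.2, hw⟩
  · intro c hc
    obtain ⟨c', hc', rfl⟩ := List.mem_map.1 hc
    exact fun heq => (hA _ _ (h c' hc').1.1.2).ne (hp heq)
  · intro c hc
    obtain ⟨c', hc', rfl⟩ := List.mem_map.1 hc
    obtain ⟨d, hd, hcut⟩ := (h c' hc').1.2
    exact ⟨_, List.mem_map_of_mem hd,
      hz.cutsTip (hlt d hd).1 (hlt d hd).2 (hlt c' hc').1 (hlt c' hc').2 hcut⟩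
  · intro c hc
    obtain ⟨c', hc', rfl⟩ := List.mem_map.1 hc
    obtain ⟨d, hd, hcut⟩ := (h c' hc').2
    exact ⟨_, List.mem_map_of_mem hd,
      hz.cutsTip (hlt d hd).1 (hlt d hd).2 (hlt c' hc').2 (hlt c' hc').1 hcut⟩

/-- The positions `f 0, …, f (m - 1)` need not exhaust `V`: a shield made of some of the edges
blocks the outer face of the whole drawing. This is what permits pruning of partial orders. -/
theorem not_isOOR_of_hasShieldedPair [Finite V] {f : ℕ → V} {m : ℕ}
    (hf : ∀ i j, i < j → j < m → f i ≠ f j)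
    (hz : ConvexSeq (fun i => p (f i)) m) {A : ℕ → ℕ → Bool}
    (hA : ∀ i j, A i j = true ↔ G.Adj (f i) (f j)) (h : hasShieldedPair A m = true) :
    ¬ IsOOR G p := by
  rintro ⟨hp, hoor⟩
  simp only [hasShieldedPair, List.any_eq_true, List.mem_range, Bool.and_eq_true,
    decide_eq_true_eq, Bool.not_eq_true'] at h
  obtain ⟨x, hx, y, hy, ⟨hxy, hnadj⟩, ⟨hS, hCx⟩, hCy⟩ := h
  have hlt := isShield_lt hS
  have hdis := disjoint_shield_outerFace hp hz (fun i j => (hA i j).1) hS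
  have := (hoor (f x) (f y) (hf x y hxy hy)).2 (hdis.mono_left
    (segment_subset_leftRegion (hz.mem_leftRegion hlt hx hCx) (hz.mem_leftRegion hlt hy hCy)))
  rw [← hA, hnadj] at this
  exact absurd this (by simp)

end Shield

/-! ### Exhaustive search over circular orders -/

/-- All the ways to insert `v` into a list. -/
def insertions {V : Type*} (v : V) : List V → List (List V)
  | [] => [[v]]
  | a :: l => (v :: a :: l) :: (insertions v l).map (a :: ·)

theorem exists_mem_insertions_pairwise {V : Type*} {e : V → ℕ} {v : V} {l : List V}
    (hl : l.Pairwise fun a b => e a < e b) (hv : ∀ a ∈ l, e v ≠ e a) :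
    ∃ l' ∈ insertions v l, l'.Pairwise (fun a b => e a < e b) ∧ l'.Perm (v :: l) := by
  induction l with
  | nil => exact ⟨[v], by simp [insertions], by simp, .refl _⟩
  | cons a l ih =>
    rw [List.pairwise_cons] at hl
    rcases lt_or_gt_of_ne (hv a (by simp)) with h | h
    · refine ⟨v :: a :: l, by simp [insertions], ?_, .refl _⟩
      refine List.pairwise_cons.2 ⟨?_, List.pairwise_cons.2 hl⟩
      intro b hb
      rcases List.mem_cons.1 hb with rfl | hb
      · exact h
      · exact h.trans (hl.1 b hb)
    · obtain ⟨l', hl', hpw, hperm⟩ := ih hl.2 fun b hb => hv b (by simp [hb])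
      refine ⟨a :: l', by simp [insertions, hl'], ?_, (hperm.cons a).trans (.swap _ _ _)⟩
      refine List.pairwise_cons.2 ⟨fun b hb => ?_, hpw⟩
      rcases List.mem_cons.1 (hperm.mem_iff.1 hb) with rfl | hb
      · exact h
      · exact hl.1 b hb

/-- Adjacency of list positions. -/
def posAdj {V : Type*} (G : SimpleGraph V) [DecidableRel G.Adj] (v : V) (l : List V) (i j : ℕ) :
    Bool :=
  decide (G.Adj (l.getD i v) (l.getD j v))

/-- Inserts the vertices of a list one by one, in all possible ways, into a circular order that
starts with `v`, discards the orders with a shielded nonadjacent pair, and checks that all complete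
orders that remain satisfy `leaf`. -/
def searchOrders {V : Type*} (G : SimpleGraph V) [DecidableRel G.Adj] (leaf : List V → Bool)
    (v : V) : List V → List V → Bool
  | [], t => hasShieldedPair (posAdj G v (v :: t)) (v :: t).length || leaf (v :: t)
  | w :: rest, t => hasShieldedPair (posAdj G v (v :: t)) (v :: t).length ||
      (insertions w t).all fun t' => searchOrders G leaf v rest t'

/-- Follow the branch on which each vertex is inserted at its true place according to `e`. An OOR
never has a shielded pair, so this branch is not pruned and ends in a list accepted by `leaf`.
Fixing `e v = 0` removes the rotations. -/
theorem searchOrders_sound {V : Type*} [Finite V] {G : SimpleGraph V} [DecidableRel G.Adj]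
    {p : V → ℂ} {leaf : List V → Bool} {v : V} {n : ℕ} {z : ℕ → ℂ} (hz : ConvexSeq z n)
    {e : V → ℕ} (he : Function.Injective e) (hen : ∀ u, e u < n) (hv : e v = 0)
    (hp : ∀ u, p u = z (e u)) (hoor : IsOOR G p) (rest t : List V)
    (hsearch : searchOrders G leaf v rest t = true)
    (ht : (v :: t).Pairwise fun a b => e a < e b) (hnd : (rest ++ (v :: t)).Nodup) :
    ∃ l, leaf l = true ∧ l.Pairwise (fun a b => e a < e b) ∧ l.Perm (rest ++ (v :: t)) := by
  have hns : ∀ t : List V, (v :: t).Pairwise (fun a b => e a < e b) →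
      ¬ hasShieldedPair (posAdj G v (v :: t)) (v :: t).length = true := by
    intro t ht hS
    have hlt : ∀ i j, i < j → j < (v :: t).length →
        e ((v :: t).getD i v) < e ((v :: t).getD j v) := by
      intro i j hij hj
      rw [List.getD_eq_getElem _ _ (hij.trans hj), List.getD_eq_getElem _ _ hj]
      exact List.pairwise_iff_getElem.1 ht i j _ _ hij
    refine not_isOOR_of_hasShieldedPair (f := fun i => (v :: t).getD i v) ?_ ?_ ?_ hS hoor
    · intro i j hij hj heq
      exact (hlt i j hij hj).ne (congrArg e heq)
    · simp only [hp]
      exact hz.comp (e := fun i => e ((v :: t).getD i v)) hlt fun i => hen _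
    · intro i j
      simp [posAdj]
  induction rest generalizing t with
  | nil =>
    simp only [searchOrders, Bool.or_eq_true] at hsearch
    exact ⟨v :: t, hsearch.resolve_left (hns t ht), ht, by simp⟩
  | cons w rest ih =>
    simp only [searchOrders, Bool.or_eq_true, List.all_eq_true] at hsearch
    have hall := hsearch.resolve_left (hns t ht)
    have hw : ∀ a ∈ v :: t, w ≠ a := fun a ha => (List.nodup_append.1 hnd).2.2 w (by simp) a ha
    rw [List.pairwise_cons] at ht
    obtain ⟨t', ht', hpw, hperm⟩ := exists_mem_insertions_pairwise (v := w) ht.2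
      fun a ha h => hw a (by simp [ha]) (he h)
    have hperm' : (rest ++ (v :: t')).Perm (w :: rest ++ (v :: t)) := by
      have h1 : (v :: t').Perm (w :: v :: t) := (hperm.cons v).trans (.swap _ _ _)
      exact (h1.append_left rest).trans List.perm_middle
    have hpw' : (v :: t').Pairwise fun a b => e a < e b := by
      refine List.pairwise_cons.2 ⟨fun b hb => ?_, hpw⟩
      rcases List.mem_cons.1 (hperm.mem_iff.1 hb) with rfl | h
      · rw [hv]
        exact Nat.pos_of_ne_zero fun h0 => hw v (by simp) (he (h0.trans hv.symm))
      · exact ht.1 b h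
    obtain ⟨l, h1, h2, h3⟩ := ih t' (hall t' ht') hpw' (hperm'.nodup_iff.2 hnd)
    exact ⟨l, h1, h2, h3.trans hperm'⟩

/-- Turns a list sorted by position into the actual positions: `n` strictly increasing values below
`n` leave no choice. -/
theorem map_eq_range_of_pairwise {V : Type*} {e : V → ℕ} {n : ℕ} {l : List V}
    (hl : l.Pairwise fun a b => e a < e b) (hlen : l.length = n) (hen : ∀ u, e u < n) :
    l.map e = List.range n := by
  have hpw : (l.map e).Pairwise (· < ·) := List.pairwise_map.2 hl
  have hperm : (l.map e).Perm (List.range n) := by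
    refine (List.subperm_of_subset (hpw.imp fun h => h.ne) ?_).perm_of_length_le ?_
    · intro k hk
      obtain ⟨u, -, rfl⟩ := List.mem_map.1 hk
      exact List.mem_range.2 (hen u)
    · simp [hlen]
  exact hperm.eq_of_pairwise (fun a b _ _ h1 h2 => absurd h1 (not_lt.2 h2.le)) hpw
    List.pairwise_lt_range

/-! ### Regular polygons -/

/-- Vertex number `k` of the regular `n`-gon with centre `c`, where `c + a` is vertex `0`. -/
noncomputable def regularVertex (n : ℕ) (c a : ℂ) (k : ℕ) : ℂ :=
  c + a * Complex.exp (2 * (Real.pi : ℂ) * Complex.I * (k : ℂ) / (n : ℂ))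

theorem exp_eq_cos_add_sin (n k : ℕ) :
    Complex.exp (2 * (Real.pi : ℂ) * Complex.I * (k : ℂ) / (n : ℂ)) =
      ⟨Real.cos (2 * (Real.pi * k / n)), Real.sin (2 * (Real.pi * k / n))⟩ := by
  have : 2 * (Real.pi : ℂ) * Complex.I * (k : ℂ) / (n : ℂ) =
      ((2 * (Real.pi * k / n) : ℝ) : ℂ) * Complex.I := by push_cast; ring
  rw [this]
  apply Complex.ext
  · rw [Complex.exp_ofReal_mul_I_re]
  · rw [Complex.exp_ofReal_mul_I_im]

/-- Doubled angles turn the area of an inscribed triangle into a product of sines of half the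
central angles, from which signs can be read off. -/
theorem orient_unit_circle (x y z : ℝ) :
    orient ⟨Real.cos (2 * x), Real.sin (2 * x)⟩ ⟨Real.cos (2 * y), Real.sin (2 * y)⟩
      ⟨Real.cos (2 * z), Real.sin (2 * z)⟩ =
      4 * (Real.sin (y - x) * Real.sin (z - y) * Real.sin (z - x)) := by
  obtain ⟨s, rfl⟩ : ∃ s, y = x + s := ⟨y - x, by ring⟩
  obtain ⟨t, rfl⟩ : ∃ t, z = x + s + t := ⟨z - (x + s), by ring⟩
  have h1 : orient ⟨Real.cos (2 * x), Real.sin (2 * x)⟩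
      ⟨Real.cos (2 * (x + s)), Real.sin (2 * (x + s))⟩
      ⟨Real.cos (2 * (x + s + t)), Real.sin (2 * (x + s + t))⟩ =
      Real.sin (2 * s) + Real.sin (2 * t) - Real.sin (2 * (s + t)) := by
    have e1 : 2 * s = 2 * (x + s) - 2 * x := by ring
    have e2 : 2 * t = 2 * (x + s + t) - 2 * (x + s) := by ring
    have e3 : 2 * (s + t) = 2 * (x + s + t) - 2 * x := by ring
    rw [e1, e2, e3, Real.sin_sub, Real.sin_sub, Real.sin_sub]
    simp only [orient]
    ring
  have e4 : x + s + t - x = s + t := by ring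
  rw [h1, e4, add_sub_cancel_left, add_sub_cancel_left]
  have hs := Real.sin_sq_add_cos_sq s
  have ht := Real.sin_sq_add_cos_sq t
  have e5 : 2 * (s + t) = 2 * s + 2 * t := by ring
  rw [e5, Real.sin_add, Real.sin_add, Real.sin_two_mul, Real.sin_two_mul, Real.cos_two_mul',
    Real.cos_two_mul']
  linear_combination (-2 * Real.sin s * Real.cos s) * ht - 2 * Real.sin t * Real.cos t * hs

theorem orient_add_mul (c a x y z : ℂ) :
    orient (c + a * x) (c + a * y) (c + a * z) = Complex.normSq a * orient x y z := by
  simp [orient, Complex.normSq_apply]; ring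

theorem orient_regularVertex (n : ℕ) (c a : ℂ) (i j k : ℕ) :
    orient (regularVertex n c a i) (regularVertex n c a j) (regularVertex n c a k) =
      Complex.normSq a * (4 * (Real.sin (Real.pi * j / n - Real.pi * i / n) *
        Real.sin (Real.pi * k / n - Real.pi * j / n) *
        Real.sin (Real.pi * k / n - Real.pi * i / n))) := by
  simp only [regularVertex]
  rw [orient_add_mul, exp_eq_cos_add_sin, exp_eq_cos_add_sin, exp_eq_cos_add_sin,
    orient_unit_circle]

theorem convexSeq_regularVertex (n : ℕ) (c : ℂ) {a : ℂ} (ha : a ≠ 0) :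
    ConvexSeq (regularVertex n c a) n := by
  intro i j k hij hjk hk
  rw [orient_regularVertex]
  have hn : (0 : ℝ) < n := by exact_mod_cast (Nat.zero_le k).trans_lt hk
  have hsin : ∀ i j : ℕ, i < j → j < n → 0 < Real.sin (Real.pi * j / n - Real.pi * i / n) := by
    intro i j hij hj
    have h1 : (i : ℝ) < j := by exact_mod_cast hij
    have h2 : (j : ℝ) < n := by exact_mod_cast hj
    have h3 : Real.pi * j / n - Real.pi * i / n = Real.pi * ((j - i) / n) := by ring
    rw [h3]
    apply Real.sin_pos_of_pos_of_lt_pi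
    · have : (0 : ℝ) < j - i := by linarith
      have := Real.pi_pos
      positivity
    · have h4 : (j - i : ℝ) / n < 1 := by
        rw [div_lt_one hn]
        have : (0 : ℝ) ≤ i := by positivity
        linarith
      nlinarith [Real.pi_pos]
  have := Complex.normSq_pos.2 ha
  have := hsin i j hij (hjk.trans hk)
  have := hsin j k hjk hk
  have := hsin i k (hij.trans hjk) hk
  positivity

theorem regularVertex_add (n : ℕ) (c a : ℂ) (i j : ℕ) :
    regularVertex n c a (i + j) = regularVertex n c
      (a * Complex.exp (2 * (Real.pi : ℂ) * Complex.I * (i : ℂ) / (n : ℂ))) j := by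
  simp only [regularVertex]
  rw [mul_assoc a, ← Complex.exp_add]
  congr 3
  push_cast; ring

theorem regularVertex_mod {n : ℕ} (hn : n ≠ 0) (c a : ℂ) (k : ℕ) :
    regularVertex n c a (k % n) = regularVertex n c a k := by
  have hn' : (n : ℂ) ≠ 0 := by exact_mod_cast hn
  conv_rhs => rw [← Nat.mod_add_div k n]
  simp only [regularVertex]
  have : 2 * (Real.pi : ℂ) * Complex.I * ((k % n + n * (k / n) : ℕ) : ℂ) / (n : ℂ) =
      2 * (Real.pi : ℂ) * Complex.I * ((k % n : ℕ) : ℂ) / (n : ℂ) +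
        (k / n : ℕ) * (2 * Real.pi * Complex.I) := by
    rw [Nat.cast_add, Nat.cast_mul]
    field_simp
  rw [this, Complex.exp_add, Complex.exp_nat_mul_two_pi_mul_I, mul_one]

/-- Reversing the order of the positions is complex conjugation; this identifies mirror images under
`SamePlacement`. -/
theorem regularVertex_neg_mod {n k : ℕ} (hn : n ≠ 0) (hk : k ≤ n) (c a : ℂ) :
    regularVertex n c a ((n - k) % n) = a * (starRingEnd ℂ) (regularVertex n 0 1 k) + c := by
  have hn' : (n : ℂ) ≠ 0 := by exact_mod_cast hn
  rw [regularVertex_mod hn]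
  simp only [regularVertex, zero_add, one_mul]
  rw [← Complex.exp_conj]
  have : 2 * (Real.pi : ℂ) * Complex.I * ((n - k : ℕ) : ℂ) / (n : ℂ) =
      (starRingEnd ℂ) (2 * (Real.pi : ℂ) * Complex.I * (k : ℂ) / (n : ℂ)) +
        2 * Real.pi * Complex.I := by
    rw [Nat.cast_sub hk]
    simp only [map_div₀, map_mul, Complex.conj_ofReal, Complex.conj_I, map_natCast, map_ofNat]
    field_simp
    ring
  rw [this, Complex.exp_add, Complex.exp_two_pi_mul_I, mul_one, add_comm]

section Placement

variable {V : Type*}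

theorem IsRegularPlacement.exists_regularVertex [Fintype V] {p : V → ℂ} (hp : IsRegularPlacement p) (v₀ : V) :
    ∃ (c a : ℂ) (e : V → ℕ), a ≠ 0 ∧ Function.Injective e ∧ (∀ v, e v < Fintype.card V) ∧
      e v₀ = 0 ∧ ∀ v, p v = regularVertex (Fintype.card V) c a (e v) := by
  obtain ⟨c, a, e, ha, he⟩ := hp
  have hn0 : Fintype.card V ≠ 0 := (Fintype.card_pos_iff.2 ⟨v₀⟩).ne'
  have hlt : ∀ v, (e v : ℕ) < Fintype.card V := fun v => (e v).2
  refine ⟨c, a * Complex.exp (2 * (Real.pi : ℂ) * Complex.I * ((e v₀ : ℕ) : ℂ) / (Fintype.card V : ℂ)),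
    fun v => ((e v : ℕ) + (Fintype.card V - e v₀)) % Fintype.card V, mul_ne_zero ha (Complex.exp_ne_zero _), ?_,
    fun v => Nat.mod_lt _ (Nat.pos_of_ne_zero hn0), ?_, ?_⟩
  · intro u v huv
    have h : (e u : ℕ) + (Fintype.card V - e v₀) ≡ (e v : ℕ) + (Fintype.card V - e v₀) [MOD Fintype.card V] := huv
    have h2 := (Nat.ModEq.add_right_cancel' _ h).eq_of_lt_of_lt (hlt u) (hlt v)
    exact e.injective (Fin.ext h2)
  · have h1 := hlt v₀
    have h2 : (e v₀ : ℕ) + (Fintype.card V - e v₀) = Fintype.card V := by omega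
    simp only [h2, Nat.mod_self]
  · intro v
    rw [regularVertex_mod hn0, ← regularVertex_add]
    have h1 := hlt v₀
    have h2 : (e v₀ : ℕ) + ((e v : ℕ) + (Fintype.card V - e v₀)) = e v + Fintype.card V := by omega
    rw [h2, ← regularVertex_mod hn0, Nat.add_mod_right, regularVertex_mod hn0, he v, regularVertex]

theorem isRegularPlacement_regularVertex [Fintype V] (c : ℂ) {a : ℂ} (ha : a ≠ 0) {e : V → ℕ}
    (he : Function.Injective e) (hlt : ∀ v, e v < Fintype.card V) :
    IsRegularPlacement fun v => regularVertex (Fintype.card V) c a (e v) := by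
  refine ⟨c, a, Equiv.ofBijective (fun v => (⟨e v, hlt v⟩ : Fin (Fintype.card V)))
    ((Fintype.bijective_iff_injective_and_card _).2 ⟨fun u v h => he (Fin.ext_iff.1 h), by simp⟩),
    ha, fun v => rfl⟩

/-! ### Certifying OORs by wedges -/

/-- The open wedge to the left of the two chords given by `w` avoids the drawing of `G` and contains
points of the segment from `x` to `y` close to `x`. -/
def IsWedge (G : SimpleGraph V) (e : V → ℕ) (w : (V × V) × V × V) (x y : V) : Prop :=
  ccw (e w.1.2) (e w.1.1) (e x) = false ∧ ccw (e w.1.1) (e w.1.2) (e y) = true ∧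
    ccw (e w.2.1) (e w.2.2) (e x) = true ∧ ∀ u v, u = v ∨ G.Adj u v →
      (ccw (e w.1.1) (e w.1.2) (e u) = false ∧ ccw (e w.1.1) (e w.1.2) (e v) = false) ∨
      (ccw (e w.2.1) (e w.2.2) (e u) = false ∧ ccw (e w.2.1) (e w.2.2) (e v) = false)

instance [Fintype V] [DecidableEq V] (G : SimpleGraph V) [DecidableRel G.Adj] (e : V → ℕ)
    (w : (V × V) × V × V) (x y : V) : Decidable (IsWedge G e w x y) :=
  inferInstanceAs (Decidable (_ ∧ _ ∧ _ ∧ _))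

theorem IsWedge.not_disjoint {G : SimpleGraph V} {e : V → ℕ} {w : (V × V) × V × V} {x y : V}
    (h : IsWedge G e w x y) {z : ℕ → ℂ} {n : ℕ} (hz : ConvexSeq z n) (hen : ∀ u, e u < n) :
    ¬ Disjoint (segment ℝ (z (e x)) (z (e y)))
      (outerFace (straightDrawing G fun v => z (e v))) := by
  obtain ⟨⟨a, b⟩, c, d⟩ := w
  obtain ⟨h1, h2, h3, h4⟩ := h
  have o1 := hz.orient_nonneg (hen a) (hen b) (hen x) h1
  have o2 := hz.orient_pos (hen a) (hen b) (hen y) h2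
  have o3 := hz.orient_pos (hen c) (hen d) (hen x) h3
  have hD : ∀ w ∈ straightDrawing G fun v => z (e v),
      orient (z (e a)) (z (e b)) w ≤ 0 ∨ orient (z (e c)) (z (e d)) w ≤ 0 := by
    have key : ∀ u v, u = v ∨ G.Adj u v → ∀ w ∈ segment ℝ (z (e u)) (z (e v)),
        orient (z (e a)) (z (e b)) w ≤ 0 ∨ orient (z (e c)) (z (e d)) w ≤ 0 := by
      intro u v huv w hw
      obtain ⟨t, ht0, ht1, rfl⟩ := mem_segment_iff_lineMap.1 hw
      have ht : 0 ≤ 1 - t := by linarith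
      rw [orient_lineMap, orient_lineMap]
      rcases h4 u v huv with ⟨hu, hv⟩ | ⟨hu, hv⟩
      · left
        have := mul_nonpos_of_nonneg_of_nonpos ht
          (hz.orient_nonpos (hen a) (hen b) (hen u) hu)
        have := mul_nonpos_of_nonneg_of_nonpos ht0
          (hz.orient_nonpos (hen a) (hen b) (hen v) hv)
        linarith
      · right
        have := mul_nonpos_of_nonneg_of_nonpos ht
          (hz.orient_nonpos (hen c) (hen d) (hen u) hu)
        have := mul_nonpos_of_nonneg_of_nonpos ht0
          (hz.orient_nonpos (hen c) (hen d) (hen v) hv)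
        linarith
    rintro w (⟨u, rfl⟩ | ⟨u, v, huv, hw⟩)
    · exact key u u (Or.inl rfl) _ (left_mem_segment ℝ _ _)
    · exact key u v (Or.inr huv) w hw
  set α := orient (z (e c)) (z (e d)) (z (e x)) with hα
  set β := orient (z (e c)) (z (e d)) (z (e y)) with hβ
  have hpos : 0 < α + |β| := by positivity
  -- Small enough that `(1 - t) * α + t * β ≥ α - t * (α + |β|) = α / 2 > 0`, while any positive `t`
  -- moves strictly inside the first half-plane.
  set t := α / (2 * (α + |β|)) with ht
  have ht0 : 0 < t := by positivity
  have ht2 : t * (α + |β|) = α / 2 := by rw [ht]; field_simp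
  have ht1 : t ≤ 1 / 2 := by
    rw [ht, div_le_div_iff₀ (by positivity) (by norm_num)]
    have := abs_nonneg β
    linarith
  rw [Set.not_disjoint_iff]
  refine ⟨AffineMap.lineMap (z (e x)) (z (e y)) t,
    mem_segment_iff_lineMap.2 ⟨t, ht0.le, by linarith, rfl⟩, mem_outerFace_of_wedge hD ?_ ?_⟩
  · rw [orient_lineMap]
    have : 0 ≤ 1 - t := by linarith
    positivity
  · rw [orient_lineMap, ← hα, ← hβ]
    nlinarith [neg_abs_le β]

theorem isOOR_of_wedges {G : SimpleGraph V} {e : V → ℕ} {z : ℕ → ℂ} {n : ℕ}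
    (hz : ConvexSeq z n) (hen : ∀ u, e u < n) (hinj : Function.Injective fun v => z (e v))
    (h : ∀ x y, x ≠ y → ¬ G.Adj x y → ∃ w, IsWedge G e w x y ∨ IsWedge G e w y x) :
    IsOOR G fun v => z (e v) := by
  refine ⟨hinj, fun x y hxy => ⟨fun hadj => ?_, fun hdis => ?_⟩⟩
  · refine Set.disjoint_left.2 fun w hw hout => hout.1 (Or.inr ⟨x, y, hadj, hw⟩)
  · by_contra hadj
    obtain ⟨w, hw | hw⟩ := h x y hxy hadj
    · exact hw.not_disjoint hz hen hdis
    · rw [segment_symm] at hdis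
      exact hw.not_disjoint hz hen hdis

end Placement

theorem ConvexSeq.injOn {z : ℕ → ℂ} {n : ℕ} (hz : ConvexSeq z n) (hn : 3 ≤ n) :
    Set.InjOn z (Set.Iio n) := by
  have key : ∀ i j, i < j → j < n → z i ≠ z j := by
    intro i j hij hj heq
    obtain ⟨k, hk, hki, hkj⟩ : ∃ k < n, k ≠ i ∧ k ≠ j := by
      by_cases h : j + 1 < n
      · exact ⟨j + 1, h, by omega, by omega⟩
      · by_cases h0 : 0 < i
        · exact ⟨0, by omega, by omega, by omega⟩
        · exact ⟨1, by omega, by omega, by omega⟩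
    have hor : ccw i j k = true ∨ ccw j i k = true := by
      simp only [ccw, Bool.or_eq_true, Bool.and_eq_true, decide_eq_true_eq]
      omega
    rcases hor with h | h
    · have := hz.orient_pos (hij.trans hj) hj hk h
      rw [heq] at this
      simp [orient] at this
    · have := hz.orient_pos hj (hij.trans hj) hk h
      rw [heq] at this
      simp [orient] at this
  intro i hi j hj heq
  by_contra hne
  rcases lt_or_gt_of_ne hne with h | h
  · exact key i j h hj heq
  · exact key j i h hi heq.symm

/-! ### Outerplanarity from noncrossing chords -/

/-- The point of the standard parabola over `k`. -/
def parabola (k : ℕ) : ℂ := ⟨k, (k : ℝ) ^ 2⟩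

theorem orient_parabola (i j k : ℕ) : orient (parabola i) (parabola j) (parabola k) =
    ((j : ℝ) - i) * ((k - i) * (k - j)) := by
  simp only [orient, parabola]; ring

theorem convexSeq_parabola (n : ℕ) : ConvexSeq parabola n := by
  intro i j k hij hjk _
  rw [orient_parabola]
  have h1 : (i : ℝ) < j := by exact_mod_cast hij
  have h2 : (j : ℝ) < k := by exact_mod_cast hjk
  exact mul_pos (by linarith) (mul_pos (by linarith) (by linarith))

theorem parabola_injective : Function.Injective parabola := fun i j h => by
  simpa [parabola] using congrArg Complex.re h

theorem orient_parabola_eq_zero {i j k : ℕ} (hij : i ≠ j)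
    (h : orient (parabola i) (parabola j) (parabola k) = 0) : k = i ∨ k = j := by
  rw [orient_parabola] at h
  have hij' : (j : ℝ) - i ≠ 0 := sub_ne_zero.2 (by exact_mod_cast hij.symm)
  rcases mul_eq_zero.1 ((mul_eq_zero.1 h).resolve_left hij') with h | h
  · exact Or.inl (by exact_mod_cast sub_eq_zero.1 h)
  · exact Or.inr (by exact_mod_cast sub_eq_zero.1 h)

theorem orient_eq_zero_of_mem_segment {x y z : ℂ} (h : z ∈ segment ℝ x y) : orient x y z = 0 := by
  obtain ⟨t, -, -, rfl⟩ := mem_segment_iff_lineMap.1 h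
  simp [orient_lineMap]

theorem isSimpleArc_segment {x y : ℂ} (h : x ≠ y) : IsSimpleArc (segment ℝ x y) x y := by
  refine ⟨⟨⟨fun t => AffineMap.lineMap x y (t : ℝ), ?_⟩, by simp, by simp⟩, ?_, ?_⟩
  · exact AffineMap.lineMap_continuous.comp continuous_subtype_val
  · exact fun s t hst => Subtype.ext (AffineMap.lineMap_injective ℝ h hst)
  · ext z
    rw [segment_eq_image_lineMap]
    constructor
    · rintro ⟨t, rfl⟩; exact ⟨t, t.2, rfl⟩
    · rintro ⟨t, ht, rfl⟩; exact ⟨⟨t, ht⟩, rfl⟩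

/-- The segment joining the ends of an unordered pair. -/
def sym2Segment {V : Type*} (p : V → ℂ) : Sym2 V → Set ℂ :=
  Sym2.lift ⟨fun u v => segment ℝ (p u) (p v), fun _ _ => segment_symm ℝ _ _⟩

/-- A graph whose edges are pairwise noncrossing chords of a convex polygon is outerplanar. -/
theorem isOuterplanar_of_noncrossing {V : Type*} {G : SimpleGraph V} {e : V → ℕ}
    (he : Function.Injective e)
    (h : ∀ u v, G.Adj u v → ∀ x y, G.Adj x y →
      (ccw (e u) (e v) (e x) = false ∧ ccw (e u) (e v) (e y) = false) ∨
      (ccw (e v) (e u) (e x) = false ∧ ccw (e v) (e u) (e y) = false)) :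
    IsOuterplanar G := by
  set p : V → ℂ := fun v => parabola (e v) with hp
  have hpinj : Function.Injective p := parabola_injective.comp he
  have hz : ∀ u v x, u ≠ v → orient (p u) (p v) (p x) = 0 → x = u ∨ x = v :=
    fun u v x huv h0 => (orient_parabola_eq_zero (he.ne huv) h0).imp (@he _ _) (@he _ _)
  refine ⟨p, fun a => sym2Segment p a, ⟨hpinj, ?_, ?_, ?_⟩, ?_⟩
  · exact fun u v huv => isSimpleArc_segment (hpinj.ne huv.ne)
  · rintro ⟨⟨u, v⟩, huv⟩ x hx
    have huv' : G.Adj u v := huv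
    exact Sym2.mem_iff.2 (hz u v x huv'.ne (orient_eq_zero_of_mem_segment hx))
  · rintro ⟨⟨u, v⟩, huv⟩ ⟨⟨x, y⟩, hxy⟩ hne w ⟨hw1, hw2⟩
    have huv' : G.Adj u v := huv
    have hxy' : G.Adj x y := hxy
    have hw0 : orient (p u) (p v) w = 0 := orient_eq_zero_of_mem_segment hw1
    obtain ⟨t, ht0, ht1, rfl⟩ := mem_segment_iff_lineMap.1 (show w ∈ segment ℝ (p x) (p y) from hw2)
    rw [orient_lineMap] at hw0
    have ht : 0 ≤ 1 - t := by linarith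
    -- Both ends of `xy` are weakly on the same side of `uv`, so the two summands of `hw0` have the
    -- same sign and both vanish.
    obtain ⟨hx, hy⟩ : (1 - t) * orient (p u) (p v) (p x) = 0 ∧
        t * orient (p u) (p v) (p y) = 0 := by
      have hc := convexSeq_parabola (e u + e v + e x + e y + 1)
      have lu : e u < e u + e v + e x + e y + 1 := by omega
      have lv : e v < e u + e v + e x + e y + 1 := by omega
      have lx : e x < e u + e v + e x + e y + 1 := by omega
      have ly : e y < e u + e v + e x + e y + 1 := by omega
      rcases h u v huv' x y hxy' with ⟨h1, h2⟩ | ⟨h1, h2⟩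
      · have h3 := mul_nonpos_of_nonneg_of_nonpos ht (hc.orient_nonpos lu lv lx h1)
        have h4 := mul_nonpos_of_nonneg_of_nonpos ht0 (hc.orient_nonpos lu lv ly h2)
        constructor <;> linarith
      · have h3 := mul_nonneg ht (hc.orient_nonneg lu lv lx h1)
        have h4 := mul_nonneg ht0 (hc.orient_nonneg lu lv ly h2)
        constructor <;> linarith
    rcases mul_eq_zero.1 hx with hx | hx
    · have h1 : t = 1 := by linarith
      rw [h1, one_mul] at hy
      exact ⟨y, ⟨Sym2.mem_iff.2 (hz u v y huv'.ne hy), Sym2.mem_mk_right x y⟩, by simp [h1]⟩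
    rcases mul_eq_zero.1 hy with hy | hy
    · exact ⟨x, ⟨Sym2.mem_iff.2 (hz u v x huv'.ne hx), Sym2.mem_mk_left x y⟩, by simp [hy]⟩
    · refine absurd (Subtype.ext ?_) hne
      have hxy'' := hxy'.ne
      rcases hz u v x huv'.ne hx with rfl | rfl <;> rcases hz _ _ y huv'.ne hy with rfl | rfl
      · exact absurd rfl hxy''
      · rfl
      · exact Sym2.eq_swap
      · exact absurd rfl hxy''
  · intro v
    -- The line from `p v` to `b` is the tangent of the parabola, directed so that its left side is
    -- the half-plane below. That half-plane avoids the drawing and has `p v` on its boundary.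
    set b : ℂ := ⟨e v - 1, (e v : ℝ) ^ 2 - 2 * e v⟩ with hb
    have horient : ∀ z : ℂ, orient (p v) b z =
        -(z.im - (e v : ℝ) ^ 2 - 2 * e v * (z.re - e v)) := by
      intro z; simp only [orient, hp, hb, parabola]; ring
    have hvert : ∀ u, orient (p v) b (p u) ≤ 0 := by
      intro u
      rw [horient]
      simp only [hp, parabola]
      nlinarith [sq_nonneg ((e u : ℝ) - e v)]
    refine Metric.mem_closure_iff.2 fun ε hε => ?_
    refine ⟨⟨e v, (e v : ℝ) ^ 2 - ε / 2⟩, ?_, ?_⟩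
    · have hpos : 0 < orient (p v) b ⟨e v, (e v : ℝ) ^ 2 - ε / 2⟩ := by
        rw [horient]
        simp only
        linarith
      refine mem_outerFace_of_wedge (fun w hw => Or.inl ?_) hpos hpos
      rcases hw with ⟨u, rfl⟩ | hw
      · exact hvert u
      · obtain ⟨⟨⟨x, y⟩, hxy⟩, hw⟩ := Set.mem_iUnion.1 hw
        obtain ⟨t, ht0, ht1, rfl⟩ :=
          mem_segment_iff_lineMap.1 (show w ∈ segment ℝ (p x) (p y) from hw)
        rw [orient_lineMap]
        have ht : 0 ≤ 1 - t := by linarith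
        have := mul_nonpos_of_nonneg_of_nonpos ht (hvert x)
        have := mul_nonpos_of_nonneg_of_nonpos ht0 (hvert y)
        linarith
    · have : p v - ⟨e v, (e v : ℝ) ^ 2 - ε / 2⟩ = ((ε / 2 : ℝ) : ℂ) * Complex.I := by
        apply Complex.ext <;> simp [hp, parabola]
      rw [dist_eq_norm, this, norm_mul, Complex.norm_I, Complex.norm_real,
        Real.norm_of_nonneg (by positivity)]
      linarith

/-! ### The metric obstruction in the regular octagon -/

/-- The midpoint of the chord `0 3` is not to the right of `1 → 4`: the sum equals `4 |a|² sin(3π/8)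
sin(π/8) (1 - sin(π/4))`. Convex position alone does not determine this sign. -/
theorem octagon_midpoint_nonneg (c a : ℂ) :
    0 ≤ orient (regularVertex 8 c a 1) (regularVertex 8 c a 4) (regularVertex 8 c a 0) +
      orient (regularVertex 8 c a 1) (regularVertex 8 c a 4) (regularVertex 8 c a 3) := by
  rw [orient_regularVertex, orient_regularVertex]
  have e1 : Real.pi * (4 : ℕ) / (8 : ℕ) - Real.pi * (1 : ℕ) / (8 : ℕ) = 3 * (Real.pi / 8) := by
    push_cast; ring
  have e2 : Real.pi * (0 : ℕ) / (8 : ℕ) - Real.pi * (4 : ℕ) / (8 : ℕ) = -(Real.pi / 2) := by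
    push_cast; ring
  have e3 : Real.pi * (0 : ℕ) / (8 : ℕ) - Real.pi * (1 : ℕ) / (8 : ℕ) = -(Real.pi / 8) := by
    push_cast; ring
  have e4 : Real.pi * (3 : ℕ) / (8 : ℕ) - Real.pi * (4 : ℕ) / (8 : ℕ) = -(Real.pi / 8) := by
    push_cast; ring
  have e5 : Real.pi * (3 : ℕ) / (8 : ℕ) - Real.pi * (1 : ℕ) / (8 : ℕ) = Real.pi / 4 := by
    push_cast; ring
  rw [e1, e2, e3, e4, e5, Real.sin_neg, Real.sin_neg, Real.sin_pi_div_two]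
  have h1 : 0 ≤ Real.sin (3 * (Real.pi / 8)) :=
    Real.sin_nonneg_of_nonneg_of_le_pi (by positivity) (by linarith [Real.pi_pos])
  have h2 : 0 ≤ Real.sin (Real.pi / 8) :=
    Real.sin_nonneg_of_nonneg_of_le_pi (by positivity) (by linarith [Real.pi_pos])
  have h3 : 0 ≤ 1 - Real.sin (Real.pi / 4) := by linarith [Real.sin_le_one (Real.pi / 4)]
  have h4 := Complex.normSq_nonneg a
  have : 0 ≤ 4 * Complex.normSq a *
      (Real.sin (3 * (Real.pi / 8)) * Real.sin (Real.pi / 8) * (1 - Real.sin (Real.pi / 4))) := by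
    positivity
  linarith

/-- The mirror image of `octagon_midpoint_nonneg` under the reflection `j ↦ 3 - j` of the octagon.
-/
theorem octagon_midpoint_nonneg' (c a : ℂ) :
    0 ≤ orient (regularVertex 8 c a 7) (regularVertex 8 c a 2) (regularVertex 8 c a 0) +
      orient (regularVertex 8 c a 7) (regularVertex 8 c a 2) (regularVertex 8 c a 3) := by
  rw [orient_regularVertex, orient_regularVertex]
  have e1 : Real.pi * (2 : ℕ) / (8 : ℕ) - Real.pi * (7 : ℕ) / (8 : ℕ) = -(5 * (Real.pi / 8)) := by
    push_cast; ring
  have e2 : Real.pi * (0 : ℕ) / (8 : ℕ) - Real.pi * (2 : ℕ) / (8 : ℕ) = -(Real.pi / 4) := by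
    push_cast; ring
  have e3 : Real.pi * (0 : ℕ) / (8 : ℕ) - Real.pi * (7 : ℕ) / (8 : ℕ) =
      -(Real.pi - Real.pi / 8) := by
    push_cast; ring
  have e4 : Real.pi * (3 : ℕ) / (8 : ℕ) - Real.pi * (2 : ℕ) / (8 : ℕ) = Real.pi / 8 := by
    push_cast; ring
  have e5 : Real.pi * (3 : ℕ) / (8 : ℕ) - Real.pi * (7 : ℕ) / (8 : ℕ) = -(Real.pi / 2) := by
    push_cast; ring
  rw [e1, e2, e3, e4, e5, Real.sin_neg, Real.sin_neg, Real.sin_neg, Real.sin_neg,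
    Real.sin_pi_div_two, Real.sin_pi_sub]
  have h1 : 0 ≤ Real.sin (5 * (Real.pi / 8)) :=
    Real.sin_nonneg_of_nonneg_of_le_pi (by positivity) (by linarith [Real.pi_pos])
  have h2 : 0 ≤ Real.sin (Real.pi / 8) :=
    Real.sin_nonneg_of_nonneg_of_le_pi (by positivity) (by linarith [Real.pi_pos])
  have h3 : 0 ≤ 1 - Real.sin (Real.pi / 4) := by linarith [Real.sin_le_one (Real.pi / 4)]
  have h4 := Complex.normSq_nonneg a
  have : 0 ≤ 4 * Complex.normSq a *
      (Real.sin (5 * (Real.pi / 8)) * Real.sin (Real.pi / 8) * (1 - Real.sin (Real.pi / 4))) := by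
    positivity
  linarith

theorem lineMap_mem_leftRegion {C : List (ℂ × ℂ)} {x y : ℂ} {t : ℝ} (hx : x ∈ leftRegion C)
    (hxy : ∀ c ∈ C, 0 ≤ orient c.1 c.2 x + orient c.1 c.2 y) (h0 : 0 ≤ t) (h1 : t ≤ 1 / 2) :
    AffineMap.lineMap x y t ∈ leftRegion C := by
  intro c hc
  rw [orient_lineMap]
  nlinarith [hx c hc, hxy c hc]

/-- In a regular octagon, the triangles `0 1 4` and `2 3 7` cover the chord `0 3`. -/
theorem not_isOOR_of_octagon_triangles {V : Type*} [Finite V] {G : SimpleGraph V} {p : V → ℂ}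
    {f : ℕ → V} {c a : ℂ} (ha : a ≠ 0) (hf : ∀ j, p (f j) = regularVertex 8 c a j)
    (h01 : G.Adj (f 0) (f 1)) (h14 : G.Adj (f 1) (f 4)) (h40 : G.Adj (f 4) (f 0))
    (h23 : G.Adj (f 2) (f 3)) (h37 : G.Adj (f 3) (f 7)) (h72 : G.Adj (f 7) (f 2))
    (h03 : ¬ G.Adj (f 0) (f 3)) : ¬ IsOOR G p := by
  classical
  rintro ⟨hpinj, hoor⟩
  have hz := convexSeq_regularVertex 8 c ha
  have hz' : ConvexSeq (fun i => p (f i)) 8 := by simpa only [hf] using hz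
  have hne : f 0 ≠ f 3 := by
    intro h
    have := hz.injOn (by norm_num) (show 0 ∈ Set.Iio 8 by simp) (show 3 ∈ Set.Iio 8 by simp)
      (by rw [← hf, ← hf, h])
    omega
  let A : ℕ → ℕ → Bool := fun i j => decide (G.Adj (f i) (f j))
  have hA : ∀ i j, A i j = true → G.Adj (f i) (f j) := fun i j h => of_decide_eq_true h
  have d1 := disjoint_shield_outerFace hpinj hz' hA (C := [(0, 1), (1, 4), (4, 0)])
    (by simp [isShield, cutsTip, ccw, A, h01, h14, h40])
  have d2 := disjoint_shield_outerFace hpinj hz' hA (C := [(2, 3), (3, 7), (7, 2)])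
    (by simp [isShield, cutsTip, ccw, A, h23, h37, h72])
  have n : ∀ i j k : ℕ, i < 8 → j < 8 → k < 8 → ccw j i k = false →
      0 ≤ orient (regularVertex 8 c a i) (regularVertex 8 c a j) (regularVertex 8 c a k) :=
    fun i j k hi hj hk h => hz.orient_nonneg hi hj hk h
  refine h03 ((hoor _ _ hne).2 (Set.disjoint_left.2 fun w hw hout => ?_))
  obtain ⟨t, ht0, ht1, rfl⟩ := mem_segment_iff_lineMap.1 hw
  -- The half of the chord at `0` lies in the triangle `0 1 4`, the half at `3` in the triangle `2 3
  -- 7`.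
  rcases le_total t (1 / 2) with ht | ht
  · refine Set.disjoint_left.1 d1 (lineMap_mem_leftRegion ?_ ?_ ht0 ht) hout
    · exact hz'.mem_leftRegion (by simp) (by norm_num) (by decide)
    · simp only [List.map_cons, List.map_nil, List.forall_mem_cons, hf]
      refine ⟨add_nonneg ?_ ?_, octagon_midpoint_nonneg c a, add_nonneg ?_ ?_, by simp⟩ <;>
        exact n _ _ _ (by norm_num) (by norm_num) (by norm_num) (by decide)
  · rw [← AffineMap.lineMap_apply_one_sub] at hout
    refine Set.disjoint_left.1 d2 (lineMap_mem_leftRegion ?_ ?_ (by linarith) (by linarith)) hout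
    · exact hz'.mem_leftRegion (by simp) (by norm_num) (by decide)
    · simp only [List.map_cons, List.map_nil, List.forall_mem_cons, hf]
      refine ⟨add_nonneg ?_ ?_, add_nonneg ?_ ?_, ?_, by simp⟩
      on_goal 5 => rw [add_comm]; exact octagon_midpoint_nonneg' c a
      all_goals exact n _ _ _ (by norm_num) (by norm_num) (by norm_num) (by decide)

/-! ### The two graphs and their regular placements -/

/-- Adjacency in the triangulated octagon. -/
def octagonAdj (u v : ℕ) : Bool :=
  [(0, 1), (0, 2), (0, 4), (0, 5), (1, 2), (2, 3), (2, 4), (3, 4), (4, 5), (1, 6), (2, 6), (0, 7),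
    (1, 7)].any fun e => (u == e.1 && v == e.2) || (u == e.2 && v == e.1)

/-- The triangulated octagon with boundary cycle `0 7 1 6 2 3 4 5`. -/
def octagonGraph : SimpleGraph (Fin 8) where
  Adj u v := octagonAdj u v = true
  symm := ⟨by decide +kernel⟩
  loopless := ⟨by decide +kernel⟩

instance : DecidableRel octagonGraph.Adj :=
  fun u v => inferInstanceAs (Decidable (octagonAdj u v = true))

/-- The triangle `0 2 4` with an ear at each side. -/
def hexagonGraph : SimpleGraph (Fin 6) := octagonGraph.comap (Fin.castLEEmb (by norm_num))

instance : DecidableRel hexagonGraph.Adj :=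
  fun u v => inferInstanceAs (Decidable (octagonAdj (u : ℕ) (v : ℕ) = true))

/-- The position of each vertex in the first regular OOR of `hexagonGraph`. -/
def firstOrder : Fin 6 → ℕ := ![0, 1, 4, 5, 2, 3]

/-- The position of each vertex in the second regular OOR of `hexagonGraph`. -/
def secondOrder : Fin 6 → ℕ := ![0, 3, 4, 1, 2, 5]

theorem isOuterplanar_octagonGraph : IsOuterplanar octagonGraph :=
  isOuterplanar_of_noncrossing (e := ![0, 2, 4, 5, 6, 7, 3, 1]) (by decide +kernel)
    (by decide +kernel)

theorem isOuterplanar_hexagonGraph : IsOuterplanar hexagonGraph :=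
  isOuterplanar_of_noncrossing (e := fun v => (v : ℕ)) Fin.val_injective (by decide +kernel)

theorem isRegularOOR_hexagon {e : Fin 6 → ℕ} (he : Function.Injective e) (hlt : ∀ v, e v < 6)
    (h : ∀ x y, x ≠ y → ¬ hexagonGraph.Adj x y →
      ∃ w, IsWedge hexagonGraph e w x y ∨ IsWedge hexagonGraph e w y x) :
    IsRegularOOR hexagonGraph fun v => regularVertex 6 0 1 (e v) := by
  have hz := convexSeq_regularVertex 6 0 one_ne_zero
  refine ⟨?_, isOOR_of_wedges hz hlt
    (fun u v huv => he (hz.injOn (by norm_num) (hlt u) (hlt v) huv)) h⟩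
  have := isRegularPlacement_regularVertex 0 one_ne_zero he (by simpa using hlt)
  simpa using this

theorem isRegularOOR_first :
    IsRegularOOR hexagonGraph fun v => regularVertex 6 0 1 (firstOrder v) := by
  refine isRegularOOR_hexagon (by decide +kernel) (by decide +kernel) ?_
  have h : ∀ x y, x ≠ y → ¬ hexagonGraph.Adj x y →
      -- One wedge for each nonadjacent side of the hexagon. Each serves the two nonadjacent pairs
      -- in which the segment leaves the ear (`1`, `5`, `3`) on that side.
      ∃ w ∈ [((2, 1), (4, 0)), ((0, 5), (2, 4)), ((4, 3), (0, 2))],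
        IsWedge hexagonGraph firstOrder w x y ∨ IsWedge hexagonGraph firstOrder w y x := by
    decide +kernel
  exact fun x y h1 h2 => (h x y h1 h2).imp fun _ hw => hw.2

theorem isRegularOOR_second :
    IsRegularOOR hexagonGraph fun v => regularVertex 6 0 1 (secondOrder v) := by
  refine isRegularOOR_hexagon (by decide +kernel) (by decide +kernel) ?_
  have h : ∀ x y, x ≠ y → ¬ hexagonGraph.Adj x y →
      ∃ w ∈ [((3, 2), (4, 0)), ((1, 0), (2, 4)), ((5, 4), (0, 2))],
        IsWedge hexagonGraph secondOrder w x y ∨ IsWedge hexagonGraph secondOrder w y x := by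
    decide +kernel
  exact fun x y h1 h2 => (h x y h1 h2).imp fun _ hw => hw.2

/-- In the first placement `0, 5` and `1, 2` are antipodal pairs, so their midpoints coincide.
Similarities preserve this, but it fails in the second placement. -/
theorem not_samePlacement_first_second :
    ¬ SamePlacement (fun v => regularVertex 6 0 1 (firstOrder v))
      (fun v => regularVertex 6 0 1 (secondOrder v)) := by
  have hopp : ∀ k, regularVertex 6 0 1 (3 + k) = -regularVertex 6 0 1 k := by
    intro k
    rw [regularVertex_add]
    have : 2 * (Real.pi : ℂ) * Complex.I * ((3 : ℕ) : ℂ) / ((6 : ℕ) : ℂ) =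
        Real.pi * Complex.I := by push_cast; ring
    rw [this, Complex.exp_pi_mul_I]
    simp [regularVertex]
  have h3 := hopp 0
  have h4 := hopp 1
  rintro ⟨a, b, -, h⟩
  have hsum : regularVertex 6 0 1 0 + regularVertex 6 0 1 5 =
      regularVertex 6 0 1 3 + regularVertex 6 0 1 4 := by
    rcases h with h | h
    · have e0 : regularVertex 6 0 1 0 = a * regularVertex 6 0 1 0 + b := h 0
      have e5 : regularVertex 6 0 1 5 = a * regularVertex 6 0 1 3 + b := h 5
      have e1 : regularVertex 6 0 1 3 = a * regularVertex 6 0 1 1 + b := h 1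
      have e2 : regularVertex 6 0 1 4 = a * regularVertex 6 0 1 4 + b := h 2
      linear_combination e0 + e5 - e1 - e2 + a * h3 - a * h4
    · have e0 : regularVertex 6 0 1 0 = a * (starRingEnd ℂ) (regularVertex 6 0 1 0) + b := h 0
      have e5 : regularVertex 6 0 1 5 = a * (starRingEnd ℂ) (regularVertex 6 0 1 3) + b := h 5
      have e1 : regularVertex 6 0 1 3 = a * (starRingEnd ℂ) (regularVertex 6 0 1 1) + b := h 1
      have e2 : regularVertex 6 0 1 4 = a * (starRingEnd ℂ) (regularVertex 6 0 1 4) + b := h 2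
      have h3' := congrArg (starRingEnd ℂ) h3
      have h4' := congrArg (starRingEnd ℂ) h4
      rw [map_neg] at h3' h4'
      linear_combination e0 + e5 - e1 - e2 + a * h3' - a * h4'
  rw [h3, h4] at hsum
  have hre := congrArg Complex.re hsum
  simp only [regularVertex, zero_add, one_mul, exp_eq_cos_add_sin, Complex.add_re,
    Complex.neg_re] at hre
  have c0 : 2 * (Real.pi * (0 : ℕ) / (6 : ℕ)) = 0 := by push_cast; ring
  have c1 : 2 * (Real.pi * (1 : ℕ) / (6 : ℕ)) = Real.pi / 3 := by push_cast; ring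
  have c5 : 2 * (Real.pi * (5 : ℕ) / (6 : ℕ)) = 2 * Real.pi - Real.pi / 3 := by push_cast; ring
  rw [c0, c1, c5, Real.cos_two_pi_sub, Real.cos_zero, Real.cos_pi_div_three] at hre
  norm_num at hre

theorem samePlacement_regularVertex {V : Type*} {n : ℕ} {c a : ℂ} (ha : a ≠ 0) {e k : V → ℕ}
    {p : V → ℂ} (hp : ∀ v, p v = regularVertex n c a (e v)) (hek : ∀ v, e v = k v) :
    SamePlacement (fun v => regularVertex n 0 1 (k v)) p :=
  ⟨a, c, ha, Or.inl fun v => by rw [hp, hek]; simp [regularVertex, add_comm]⟩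

theorem samePlacement_regularVertex_mirror {V : Type*} {n : ℕ} (hn : n ≠ 0) {c a : ℂ}
    (ha : a ≠ 0) {e k : V → ℕ} {p : V → ℂ} (hp : ∀ v, p v = regularVertex n c a (e v))
    (hk : ∀ v, k v ≤ n) (hek : ∀ v, e v = (n - k v) % n) :
    SamePlacement (fun v => regularVertex n 0 1 (k v)) p :=
  ⟨a, c, ha, Or.inr fun v => by rw [hp, hek, regularVertex_neg_mod hn (hk v)]⟩

/-- The third and fourth lists are the first and second read backwards from `0`, that is, their
mirror images. -/
theorem searchOrders_hexagonGraph : searchOrders hexagonGraph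
    (fun l => [[0, 1, 4, 5, 2, 3], [0, 3, 4, 1, 2, 5], [0, 3, 2, 5, 4, 1],
      [0, 5, 2, 1, 4, 3]].contains l) 0 [1, 2, 3, 4, 5] [] = true := by
  decide +kernel

theorem samePlacement_of_isRegularOOR_hexagonGraph {p : Fin 6 → ℂ}
    (h : IsRegularOOR hexagonGraph p) :
    SamePlacement (fun v => regularVertex 6 0 1 (firstOrder v)) p ∨
      SamePlacement (fun v => regularVertex 6 0 1 (secondOrder v)) p := by
  obtain ⟨hreg, hoor⟩ := h
  obtain ⟨c, a, e, ha, he, hlt, h0, hp⟩ := hreg.exists_regularVertex 0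
  rw [Fintype.card_fin] at hlt hp
  obtain ⟨l, hl, hpw, hperm⟩ := searchOrders_sound (convexSeq_regularVertex 6 c ha) he hlt h0 hp
    hoor _ _ searchOrders_hexagonGraph (by simp) (by decide)
  have hmap := map_eq_range_of_pairwise hpw (by simpa using hperm.length_eq) hlt
  have hr : List.range 6 = [0, 1, 2, 3, 4, 5] := by decide
  rw [hr] at hmap
  simp only [List.contains_iff_mem, List.mem_cons, List.not_mem_nil, or_false] at hl
  rcases hl with rfl | rfl | rfl | rfl <;>
    simp only [List.map_cons, List.map_nil, List.cons.injEq, and_true] at hmap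
  · refine Or.inl (samePlacement_regularVertex ha hp ?_)
    simp [Fin.forall_fin_succ, firstOrder, hmap]
  · refine Or.inr (samePlacement_regularVertex ha hp ?_)
    simp [Fin.forall_fin_succ, secondOrder, hmap]
  · refine Or.inl (samePlacement_regularVertex_mirror (by norm_num) ha hp (by decide) ?_)
    simp [Fin.forall_fin_succ, firstOrder, hmap]
  · refine Or.inr (samePlacement_regularVertex_mirror (by norm_num) ha hp (by decide) ?_)
    simp [Fin.forall_fin_succ, secondOrder, hmap]

/-- Some rotation of the positions `0, …, 7` satisfies the hypotheses of
`not_isOOR_of_octagon_triangles`. -/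
def hasTriangles (A : ℕ → ℕ → Bool) : Bool :=
  -- Rotations suffice: the reflection `j ↦ 3 - j` swaps the two triangles and preserves the chord
  -- `0 3`.
  (List.range 8).any fun i =>
    let s := fun a b => A ((i + a) % 8) ((i + b) % 8)
    s 0 1 && s 1 4 && s 4 0 && s 2 3 && s 3 7 && s 7 2 && !s 0 3

/-- The ears `6` and `7` are inserted last, so the search first prunes the orders of the hexagon on
`0, …, 5` and then extends only the survivors. -/
theorem searchOrders_octagonGraph : searchOrders octagonGraph
    (fun l => hasTriangles (posAdj octagonGraph 0 l)) 0 [1, 2, 3, 4, 5, 6, 7] [] = true := by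
  decide +kernel

theorem not_isRegularOOR_octagonGraph (q : Fin 8 → ℂ) : ¬ IsRegularOOR octagonGraph q := by
  rintro ⟨hreg, hoor⟩
  obtain ⟨c, a, e, ha, he, hlt, h0, hq⟩ := hreg.exists_regularVertex 0
  rw [Fintype.card_fin] at hlt hq
  obtain ⟨l, hl, hpw, hperm⟩ := searchOrders_sound (convexSeq_regularVertex 8 c ha) he hlt h0 hq
    hoor _ _ searchOrders_octagonGraph (by simp) (by decide)
  have hlen : l.length = 8 := by simpa using hperm.length_eq
  have hmap := map_eq_range_of_pairwise hpw hlen hlt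
  simp only [hasTriangles, posAdj, List.any_eq_true, List.mem_range, Bool.and_eq_true,
    decide_eq_true_eq, Bool.not_eq_true', decide_eq_false_iff_not] at hl
  obtain ⟨i, hi, ⟨⟨⟨⟨⟨h01, h14⟩, h40⟩, h23⟩, h37⟩, h72⟩, h03⟩ := hl
  refine not_isOOR_of_octagon_triangles (f := fun j => l.getD ((i + j) % 8) 0) (c := c)
    (a := a * Complex.exp (2 * (Real.pi : ℂ) * Complex.I * (i : ℂ) / ((8 : ℕ) : ℂ)))
    (mul_ne_zero ha (Complex.exp_ne_zero _)) (fun j => ?_) h01 h14 h40 h23 h37 h72 h03 hoor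
  rw [← regularVertex_add, ← regularVertex_mod (by norm_num), hq]
  have hj : (i + j) % 8 < l.length := by omega
  congr 1
  have h1 : (l.map e)[(i + j) % 8]'(by simpa using hj) = (i + j) % 8 := by simp [hmap]
  rw [List.getD_eq_getElem _ _ hj]
  simpa using h1

theorem mainTheorem8 :
    ∃ (G : SimpleGraph (Fin 6)) (H : SimpleGraph (Fin 8)) (f : G ↪g H)
      (a b c : Fin 6) (u w : Fin 8),
      -- the 6-vertex graph is outerplanar with exactly two regular OORs, up to symmetry
      IsOuterplanar G ∧
      (∃ p₁ p₂ : Fin 6 → ℂ, IsRegularOOR G p₁ ∧ IsRegularOOR G p₂ ∧ ¬ SamePlacement p₁ p₂ ∧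
        ∀ p : Fin 6 → ℂ, IsRegularOOR G p → SamePlacement p₁ p ∨ SamePlacement p₂ p) ∧
      -- the 8-vertex graph arises by adding `u` and `w`, each joined to the ends of an edge
      u ≠ w ∧ u ∉ Set.range f ∧ w ∉ Set.range f ∧
      a ≠ b ∧ G.Adj a c ∧ G.Adj b c ∧
      H.neighborSet u = {f b, f c} ∧ H.neighborSet w = {f a, f c} ∧
      -- the 8-vertex graph is outerplanar and no placement of it is a regular OOR
      IsOuterplanar H ∧
      ∀ q : Fin 8 → ℂ, ¬ IsRegularOOR H q := by
  refine ⟨hexagonGraph, octagonGraph, SimpleGraph.Embedding.comap _ _, 0, 2, 1, 6, 7,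
    isOuterplanar_hexagonGraph, ⟨_, _, isRegularOOR_first, isRegularOOR_second,
      not_samePlacement_first_second, fun p => samePlacement_of_isRegularOOR_hexagonGraph⟩,
    by decide, ?_, ?_, by decide, by decide, by decide, ?_, ?_, isOuterplanar_octagonGraph,
    not_isRegularOOR_octagonGraph⟩
  · rintro ⟨v, hv⟩
    exact absurd (congrArg Fin.val hv) (Nat.ne_of_lt v.2)
  · rintro ⟨v, hv⟩
    exact absurd (congrArg Fin.val hv) (Nat.ne_of_lt (v.2.trans (by decide)))
  · ext v
    exact (by decide +kernel : ∀ v, octagonGraph.Adj 6 v ↔ v = 2 ∨ v = 1) v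
  · ext v
    exact (by decide +kernel : ∀ v, octagonGraph.Adj 7 v ↔ v = 0 ∨ v = 1) v
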